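/- Let $s\ge 1$ and let $H$ be a simply connected Lie group whose (finite-dimensional, real) Lie algebra is graded, $\mathfrak h=\bigoplus_{j=1}^{s}V_j$ with $[V_i,V_j]\subset V_{i+j}$ ($V_k=0$ for $k>s$). Identify $H$ with $\mathfrak h$ through the exponential map, so that the group law $gh$ is given by the Baker–Campbell–Hausdorff formula, the identity is $0$ and $g^{-1}=-g$. Write $g=(g_1,\dots,g_s)$ with $g_j\in V_j$, and let $|g_j|$ be the Euclidean norm of $g_j$ in linear coordinates fixed on $V_j$. For $t\ge 0$ let $\delta_t(g)=(tg_1,t^2g_2,\dots,t^sg_s)$, and let $\tilde\pi(g)=(g_1,0,\dots,0)$. For positive numbers $\lambda_2,\dots,\lambda_s$ define $N_1(g)=|g_1|$ and $$N_k(g)=\left(N_{k-1}(g)^{2\,k!}+\lambda_k|g_k|^{2\,(k-1)!}\right)^{1/(2\,k!)},\qquad 2\le k\le s,$$ and put $N=N_s$ and $NH(g)=N(\tilde\pi(g)^{-1}g)$. Then there are $\lambda_2,\dots,\lambda_s>0$ and $C>0$, depending only on $H$ (with its grading and the coordinates), such that $N$ is a homogeneous quasi-norm, i.e. $N$ is continuous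 and non-negative, $N(g^{-1})=N(g)$, $N(\delta_t(g))=tN(g)$ for $t\ge0$, $N(g)=0$ if and only if $g=0$, and $N(gh)\le K(N(g)+N(h))$ for all $g,h\in H$ with some constant $K$; and such that for all $g,h\in H$ $$\frac12\left(N(g)^{2\,s!}+N(h)^{2\,s!}\right)\ \ge\ \left(\frac{N(gh)}{2}\right)^{2\,s!}+C\,2^{-2\,s!}\left(|g_1-h_1|^{2\,s!}+NH(gh)^{2\,s!}\right).$$ -/

import Mathlib

/-!
Simply connected graded nilpotent Lie groups in exponential coordinates.

For a finite-dimensional real Lie algebra `𝔥` with a grading `𝔥 = V 1 ⊕ ⋯ ⊕ V s`, the exponential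
map is a diffeomorphism from `𝔥` onto the simply connected Lie group `H` with Lie algebra `𝔥`.
As usual, an element of `H` is identified with its logarithm in `𝔥`: the group law is given by the
Baker-Campbell-Hausdorff formula, the identity is `0`, and the inverse of `x` is `-x`.
-/

namespace GradedNilpotent

open scoped Nat

noncomputable section

section BCH

variable {L : Type*} [LieRing L]

/-- The right-nested bracket `⁅x₁, ⁅x₂, …, ⁅xₙ₋₁, xₙ⁆…⁆⁆` of a list; it is `x₁` if `n = 1`. -/
def nestedBracket : List L → L
  | [] => 0
  | [x] => x
  | x :: y :: l => ⁅x, nestedBracket (y :: l)⁆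

/-- The word `x^(r₁) y^(t₁) ⋯ x^(rₖ) y^(tₖ)`, where `p i = (rᵢ, tᵢ)`. -/
def bchWord {k : ℕ} (p : Fin k → ℕ × ℕ) (x y : L) : List L :=
  (List.ofFn fun i => List.replicate (p i).1 x ++ List.replicate (p i).2 y).flatten

/-- The Baker-Campbell-Hausdorff series `log (exp x exp y)` in Dynkin's form, over brackets of
length at most `n`. It is the full series if all brackets of length more than `n` vanish in `L`,
and this is the only case in which it is used. -/
def bch [LieAlgebra ℝ L] (n : ℕ) (x y : L) : L :=
  ∑ k ∈ Finset.Icc 1 n,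
    ∑ p ∈ (Fintype.piFinset fun _ : Fin k => Finset.range (n + 1) ×ˢ Finset.range (n + 1)) with
        (∀ i, 0 < (p i).1 + (p i).2) ∧ ∑ i, ((p i).1 + (p i).2) ≤ n,
      (((-1 : ℝ) ^ (k - 1) / (k : ℝ)) *
          ((∑ i, ((p i).1 + (p i).2) : ℕ) : ℝ)⁻¹ *
          ((∏ i, (p i).1 ! * (p i).2 ! : ℕ) : ℝ)⁻¹) •
        nestedBracket (bchWord p x y)

end BCH

section Group

variable {𝔥 : Type*} [LieRing 𝔥] [LieAlgebra ℝ 𝔥]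
  (V : ℕ → Submodule ℝ 𝔥) [GradedLieAlgebra V]

/-- The component `x_j ∈ V j` of `x`. -/
def component (j : ℕ) (x : 𝔥) : V j := DirectSum.decompose V x j

/-- The projection `(x₁, x₂, …, x_s) ↦ (x₁, 0, …, 0)` to the horizontal layer. -/
def horizontal (x : 𝔥) : 𝔥 := (component V 1 x : 𝔥)

/-- The dilation `(x₁, x₂, …, x_s) ↦ (t x₁, t² x₂, …, t^s x_s)`. -/
def dilation (s : ℕ) (t : ℝ) (x : 𝔥) : 𝔥 :=
  ∑ j ∈ Finset.Icc 1 s, t ^ j • (component V j x : 𝔥)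

/-- The coordinate vector of `x_j` in a basis of the layer `V j`, as a vector of Euclidean space;
`‖coord V b j x‖` is the Euclidean norm `|x_j|`. -/
def coord (b : ∀ j, Module.Basis (Fin (Module.finrank ℝ (V j))) ℝ (V j)) (j : ℕ) (x : 𝔥) :
    EuclideanSpace ℝ (Fin (Module.finrank ℝ (V j))) :=
  WithLp.toLp 2 fun a => (b j).repr (component V j x) a

/-- The functions `N_k` for weights `lam 2, lam 3, …`: `N_1 x = |x₁|` and
`N_k x = (N_{k-1} x ^ (2 k!) + lam k |x_k| ^ (2 (k-1)!)) ^ (1 / (2 k!))` for `k ≥ 2`. In particular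
`N_2 x = (|x₁| ^ 4 + lam 2 |x₂| ^ 2) ^ (1 / 4)`. The value at `k = 0` plays no role. -/
def groupNorm (b : ∀ j, Module.Basis (Fin (Module.finrank ℝ (V j))) ℝ (V j)) (lam : ℕ → ℝ) :
    ℕ → 𝔥 → ℝ
  | 0, _ => 0
  | 1, x => ‖coord V b 1 x‖
  | k + 2, x =>
      (groupNorm b lam (k + 1) x ^ (2 * (k + 2)!) +
        lam (k + 2) * ‖coord V b (k + 2) x‖ ^ (2 * (k + 1)!)) ^ (1 / (2 * ((k + 2)! : ℝ)))

/-- `NH x = N (π(x)⁻¹ x)`, the distance of `x` to its horizontal projection `π(x)`. -/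
def nonhorizontality (s : ℕ) (N : 𝔥 → ℝ) (x : 𝔥) : ℝ :=
  N (bch s (-horizontal V x) x)

/-- `N` is a homogeneous quasi-norm on the group `(𝔥, bch s)`. -/
structure IsHomogeneousQuasiNorm [TopologicalSpace 𝔥] (s : ℕ) (N : 𝔥 → ℝ) : Prop where
  continuous : Continuous N
  nonneg : ∀ x, 0 ≤ N x
  inv : ∀ x, N (-x) = N x
  dilation : ∀ t : ℝ, 0 ≤ t → ∀ x, N (dilation V s t x) = t * N x
  eq_zero_iff : ∀ x, N x = 0 ↔ x = 0
  quasi_triangle : ∃ K : ℝ, ∀ x y, N (bch s x y) ≤ K * (N x + N y)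

end Group

end

end GradedNilpotent

/-! The proof is an induction on the layer `k`. Put `p = 2 * k !` and work with `N_k ^ p`. The
defect `S` of `N_k` is the mean of `N_k ^ p` over `g` and `h`, minus `(N_k (gh) / 2) ^ p`. The claim
carried along (`DefectControls`) is that `S` is not merely nonnegative: up to a constant it bounds
`δ ^ p`, where `δ` measures how far `g` and `h` are, through degree `k`, from one common horizontal
element. For `k = 1` this is the parallelogram law.

In the step, let `T` be the mean of `N_k ^ p` over `g` and `h`. Convexity of `t ^ (k + 1)` yields a
gain `S * T ^ k`. The new layer is additive up to iterated brackets. Elements close to a common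
horizontal element almost commute, so these brackets have size at most a constant times `δ * R ^ k`,
with `R ^ p` at most a constant times `T`; their `p`-th power is therefore at most `B * S * T ^ k`
(`DefectControls.exists_tail_le`). A small weight `λ_{k+1}` lets the gain absorb this error
(`pow_convexity_gain`), and what remains controls the new layer of `g`, `h`, `gh` and of the
vertical part of `gh` (`DefectControls.exists_succ`). The weights are chosen one after another, each
depending on the previous ones.

At `k = s`, `δ` bounds both `|g₁ - h₁|` and `NH (gh)`, which is the stated inequality; nonnegativity
of the defect gives the quasi-triangle inequality. -/

namespace GradedNilpotent

open scoped Nat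

/-! ### Layer coordinates and bounds for the graded bracket -/

section Components

variable {𝔥 : Type*} [LieRing 𝔥] [LieAlgebra ℝ 𝔥]
  (V : ℕ → Submodule ℝ 𝔥) [GradedLieAlgebra V]
  (b : ∀ j, Module.Basis (Fin (Module.finrank ℝ (V j))) ℝ (V j))

/-- The coordinates of a vector of the layer `V j`, as a linear equivalence. -/
noncomputable def layerEquiv (j : ℕ) :
    V j ≃ₗ[ℝ] EuclideanSpace ℝ (Fin (Module.finrank ℝ (V j))) :=
  (b j).equivFun.trans (WithLp.linearEquiv 2 ℝ (Fin (Module.finrank ℝ (V j)) → ℝ)).symm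

/-- The projection of a graded Lie algebra to its layer `V j`. -/
noncomputable def layerProj (j : ℕ) : 𝔥 →ₗ[ℝ] V j :=
  DirectSum.component ℝ ℕ (fun i => V i) j ∘ₗ (DirectSum.decomposeLinearEquiv V).toLinearMap

/-- The coordinates `coord V b j` as a linear map. -/
noncomputable def coordₗ (j : ℕ) :
    𝔥 →ₗ[ℝ] EuclideanSpace ℝ (Fin (Module.finrank ℝ (V j))) :=
  (layerEquiv V b j).toLinearMap ∘ₗ layerProj V j

theorem coord_eq_layerEquiv (j : ℕ) (x : 𝔥) :
    coord V b j x = layerEquiv V b j (component V j x) := rfl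

theorem coordₗ_apply (j : ℕ) (x : 𝔥) : coordₗ V b j x = coord V b j x := rfl

theorem coord_add (j : ℕ) (x y : 𝔥) :
    coord V b j (x + y) = coord V b j x + coord V b j y := (coordₗ V b j).map_add x y

theorem coord_sub (j : ℕ) (x y : 𝔥) :
    coord V b j (x - y) = coord V b j x - coord V b j y := (coordₗ V b j).map_sub x y

theorem coord_neg (j : ℕ) (x : 𝔥) : coord V b j (-x) = -coord V b j x := (coordₗ V b j).map_neg x

theorem coord_smul (j : ℕ) (t : ℝ) (x : 𝔥) : coord V b j (t • x) = t • coord V b j x :=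
  (coordₗ V b j).map_smul t x

theorem coord_zero (j : ℕ) : coord V b j 0 = 0 := (coordₗ V b j).map_zero

theorem coord_sum {ι : Type*} (j : ℕ) (t : Finset ι) (f : ι → 𝔥) :
    coord V b j (∑ i ∈ t, f i) = ∑ i ∈ t, coord V b j (f i) := map_sum (coordₗ V b j) f t

theorem component_coe_same (j : ℕ) (v : V j) : component V j (v : 𝔥) = v :=
  Subtype.ext (DirectSum.decompose_of_mem_same V v.2)

theorem component_of_mem_ne {i j : ℕ} {x : 𝔥} (hx : x ∈ V i) (h : i ≠ j) :
    component V j x = 0 :=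
  Subtype.ext (DirectSum.decompose_of_mem_ne V hx h)

theorem component_add (j : ℕ) (x y : 𝔥) :
    component V j (x + y) = component V j x + component V j y := (layerProj V j).map_add x y

theorem component_neg (j : ℕ) (x : 𝔥) : component V j (-x) = -component V j x :=
  (layerProj V j).map_neg x

theorem component_zero (j : ℕ) : component V j (0 : 𝔥) = 0 := (layerProj V j).map_zero

theorem coord_component_same (j : ℕ) (x : 𝔥) :
    coord V b j (component V j x : 𝔥) = coord V b j x := by
  rw [coord_eq_layerEquiv, component_coe_same, coord_eq_layerEquiv]

theorem coord_of_mem_ne {i j : ℕ} {x : 𝔥} (hx : x ∈ V i) (h : i ≠ j) : coord V b j x = 0 := by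
  rw [coord_eq_layerEquiv, component_of_mem_ne V hx h, map_zero]

theorem coord_eq_zero_iff (j : ℕ) (x : 𝔥) : coord V b j x = 0 ↔ component V j x = 0 := by
  rw [coord_eq_layerEquiv, LinearEquiv.map_eq_zero_iff]

theorem coord_of_eq_bot {j : ℕ} (h : V j = ⊥) (x : 𝔥) : coord V b j x = 0 := by
  rw [coord_eq_zero_iff]
  exact Subtype.ext ((Submodule.mem_bot ℝ).1 (h ▸ (component V j x).2))

theorem eq_zero_of_coord_eq_zero {x : 𝔥} (h : ∀ j, coord V b j x = 0) : x = 0 := by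
  have : DirectSum.decompose V x = 0 := by
    ext j : 1
    exact (coord_eq_zero_iff V b j x).1 (h j)
  simpa using congrArg (DirectSum.decompose V).symm this

theorem coord_lie (k : ℕ) (x y : 𝔥) :
    coord V b k ⁅x, y⁆ = ∑ p ∈ Finset.HasAntidiagonal.antidiagonal k,
      coord V b k ⁅(component V p.1 x : 𝔥), (component V p.2 y : 𝔥)⁆ := by
  induction x using DirectSum.Decomposition.inductionOn V with
  | zero => simp [component_zero, coord_zero]
  | add x x' hx hx' =>
    simp only [add_lie, coord_add, component_add, Submodule.coe_add, hx, hx', Finset.sum_add_distrib]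
  | @homogeneous i u =>
    induction y using DirectSum.Decomposition.inductionOn V with
    | zero => simp [component_zero, coord_zero]
    | add y y' hy hy' =>
      simp only [lie_add, coord_add, component_add, Submodule.coe_add, hy, hy',
        Finset.sum_add_distrib]
    | @homogeneous j v =>
      by_cases hij : i + j = k
      · rw [Finset.sum_eq_single (i, j)]
        · simp only [component_coe_same]
        · rintro ⟨i', j'⟩ - hne
          by_cases hi : i = i'
          · have hj : j ≠ j' := fun hj => hne (by rw [hi, hj])
            simp [component_of_mem_ne V v.2 hj, coord_zero]
          · simp [component_of_mem_ne V u.2 hi, coord_zero]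
        · intro h
          exact absurd (Finset.HasAntidiagonal.mem_antidiagonal.2 hij) h
      · rw [coord_of_mem_ne V b (SetLike.GradedBracket.bracket_mem u.2 v.2) hij]
        refine (Finset.sum_eq_zero ?_).symm
        rintro ⟨i', j'⟩ hp
        rw [Finset.HasAntidiagonal.mem_antidiagonal] at hp
        by_cases hi : i = i'
        · have hj : j ≠ j' := fun hj => hij (by rw [hi, hj]; exact hp)
          simp [component_of_mem_ne V v.2 hj, coord_zero]
        · simp [component_of_mem_ne V u.2 hi, coord_zero]

/-- `M` bounds the bracket of homogeneous elements of total degree at most `s`. -/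
def BracketBound (s : ℕ) (M : ℝ) : Prop :=
  ∀ k ≤ s, ∀ i j, ∀ x y : 𝔥,
    ‖coord V b k ⁅(component V i x : 𝔥), (component V j y : 𝔥)⁆‖ ≤
      M * (‖coord V b i x‖ * ‖coord V b j y‖)

/-- Read in coordinates, the bracket is a bilinear map between finite-dimensional Euclidean spaces,
hence bounded. -/
theorem exists_bracket_bound_degree (k i j : ℕ) :
    ∃ M : ℝ, 0 ≤ M ∧ ∀ x y : 𝔥,
      ‖coord V b k ⁅(component V i x : 𝔥), (component V j y : 𝔥)⁆‖ ≤
        M * (‖coord V b i x‖ * ‖coord V b j y‖) := by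
  let f : EuclideanSpace ℝ (Fin (Module.finrank ℝ (V i))) →ₗ[ℝ]
      EuclideanSpace ℝ (Fin (Module.finrank ℝ (V j))) →ₗ[ℝ]
      EuclideanSpace ℝ (Fin (Module.finrank ℝ (V k))) :=
    (((LieModule.toEnd ℝ 𝔥 𝔥 : 𝔥 →ₗ[ℝ] Module.End ℝ 𝔥).compl₁₂
      ((V i).subtype ∘ₗ (layerEquiv V b i).symm.toLinearMap)
      ((V j).subtype ∘ₗ (layerEquiv V b j).symm.toLinearMap))).compr₂ (coordₗ V b k)
  let F := (LinearMap.toContinuousLinearMap.toLinearMap ∘ₗ f).toContinuousLinearMap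
  refine ⟨‖F‖, F.opNorm_nonneg, fun x y => ?_⟩
  have h := F.le_opNorm₂ (coord V b i x) (coord V b j y)
  have e : F (coord V b i x) (coord V b j y) =
      coord V b k ⁅(component V i x : 𝔥), (component V j y : 𝔥)⁆ := by
    simp [F, f, coord_eq_layerEquiv, coordₗ_apply]
  rw [e] at h
  linarith

theorem exists_bracketBound (s : ℕ) (hV : ∀ j, j = 0 ∨ s < j → V j = ⊥) :
    ∃ M : ℝ, 0 ≤ M ∧ BracketBound V b s M := by
  choose M hM0 hM using exists_bracket_bound_degree V b
  refine ⟨∑ k ∈ Finset.range (s + 1), ∑ i ∈ Finset.range (s + 1), ∑ j ∈ Finset.range (s + 1),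
    M k i j, Finset.sum_nonneg fun k _ => Finset.sum_nonneg fun i _ =>
      Finset.sum_nonneg fun j _ => hM0 k i j, fun k hk i j x y => ?_⟩
  by_cases hi : s < i
  · have h0 := coord_of_eq_bot V b (hV i (Or.inr hi)) x
    have h1 := (coord_eq_zero_iff V b i x).1 h0
    simp [h0, h1, coord_zero]
  by_cases hj : s < j
  · have h0 := coord_of_eq_bot V b (hV j (Or.inr hj)) y
    have h1 := (coord_eq_zero_iff V b j y).1 h0
    simp [h0, h1, coord_zero]
  refine (hM k i j x y).trans (mul_le_mul_of_nonneg_right ?_ (by positivity))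
  have hk' : k ∈ Finset.range (s + 1) := Finset.mem_range.2 (by omega)
  have hi' : i ∈ Finset.range (s + 1) := Finset.mem_range.2 (by omega)
  have hj' : j ∈ Finset.range (s + 1) := Finset.mem_range.2 (by omega)
  calc M k i j ≤ ∑ j ∈ Finset.range (s + 1), M k i j :=
        Finset.single_le_sum (f := fun j => M k i j) (fun j _ => hM0 k i j) hj'
    _ ≤ ∑ i ∈ Finset.range (s + 1), ∑ j ∈ Finset.range (s + 1), M k i j :=
        Finset.single_le_sum (f := fun i => ∑ j ∈ Finset.range (s + 1), M k i j)
          (fun i _ => Finset.sum_nonneg fun j _ => hM0 k i j) hi'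
    _ ≤ _ := Finset.single_le_sum
          (f := fun k => ∑ i ∈ Finset.range (s + 1), ∑ j ∈ Finset.range (s + 1), M k i j)
          (fun k _ => Finset.sum_nonneg fun i _ => Finset.sum_nonneg fun j _ => hM0 k i j) hk'

end Components

/-! ### The linear part of the Baker-Campbell-Hausdorff series -/

section BCH

theorem length_bchWord {L : Type*} {k : ℕ} (p : Fin k → ℕ × ℕ) (x y : L) :
    (bchWord p x y).length = ∑ i, ((p i).1 + (p i).2) := by
  simp [bchWord, List.length_flatten, List.sum_ofFn, Function.comp_def]

theorem eq_or_eq_of_mem_bchWord {L : Type*} {k : ℕ} {p : Fin k → ℕ × ℕ} {x y z : L}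
    (hz : z ∈ bchWord p x y) : z = x ∨ z = y := by
  simp only [bchWord, List.mem_flatten, List.mem_ofFn] at hz
  obtain ⟨l, ⟨i, rfl⟩, hl⟩ := hz
  rw [List.mem_append] at hl
  exact hl.imp List.eq_of_mem_replicate List.eq_of_mem_replicate

variable {L : Type*} [LieRing L] [LieAlgebra ℝ L]

/-- The part of the Baker-Campbell-Hausdorff series of brackets of length between `2` and `n`. -/
noncomputable def bchTail (n : ℕ) (x y : L) : L :=
  ∑ k ∈ Finset.Icc 1 n,
    ∑ p ∈ (Fintype.piFinset fun _ : Fin k => Finset.range (n + 1) ×ˢ Finset.range (n + 1)) with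
        (∀ i, 0 < (p i).1 + (p i).2) ∧ ∑ i, ((p i).1 + (p i).2) ≤ n,
      (((-1 : ℝ) ^ (k - 1) / (k : ℝ)) *
          ((∑ i, ((p i).1 + (p i).2) : ℕ) : ℝ)⁻¹ *
          ((∏ i, (p i).1 ! * (p i).2 ! : ℕ) : ℝ)⁻¹) •
        (if 2 ≤ ∑ i, ((p i).1 + (p i).2) then nestedBracket (bchWord p x y) else 0)

/-- `bchTail` has the same index set as `bch`, so the difference is taken term by term. Only words
of length one survive: `x` and `y`, each with coefficient 1. -/
theorem bch_eq_add_tail {n : ℕ} (hn : 1 ≤ n) (x y : L) :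
    bch n x y = x + y + bchTail n x y := by
  rw [← sub_eq_iff_eq_add, bch, bchTail, ← Finset.sum_sub_distrib]
  simp_rw [← Finset.sum_sub_distrib, ← smul_sub]
  rw [Finset.sum_eq_single 1]
  · have hne : (fun _ : Fin 1 => ((1, 0) : ℕ × ℕ)) ≠ fun _ => (0, 1) := by
      intro h
      simpa using congrFun h 0
    rw [← Finset.sum_subset (s₁ := {(fun _ : Fin 1 => ((1, 0) : ℕ × ℕ)), fun _ => (0, 1)}),
      Finset.sum_pair hne]
    · simp [bchWord, nestedBracket]
    · intro p hp
      simp only [Finset.mem_insert, Finset.mem_singleton] at hp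
      rcases hp with rfl | rfl <;> simp [Fintype.mem_piFinset] <;> omega
    · intro p hp hp'
      simp only [Finset.mem_filter, Fin.forall_fin_one, Finset.univ_unique, Fin.default_eq_zero,
        Finset.sum_singleton] at hp
      rw [if_pos, sub_self, smul_zero]
      by_contra hlt
      simp only [Finset.univ_unique, Fin.default_eq_zero, Finset.sum_singleton] at hlt
      refine hp' ?_
      simp only [Finset.mem_insert, Finset.mem_singleton]
      have : p 0 = (1, 0) ∨ p 0 = (0, 1) := by
        rcases h : p 0 with ⟨u, v⟩
        rw [h] at hp hlt
        simp only [Prod.mk.injEq] at hp hlt ⊢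
        omega
      refine this.imp (fun h => ?_) fun h => ?_ <;>
      · funext i
        rw [Subsingleton.elim i 0, h]
  · intro k hk hk1
    refine Finset.sum_eq_zero fun p hp => ?_
    rw [if_pos, sub_self, smul_zero]
    -- Every block is nonempty, so `k ≥ 2` blocks form a word of length at least 2.
    have h1 : ∑ i : Fin k, 1 ≤ ∑ i, ((p i).1 + (p i).2) :=
      Finset.sum_le_sum fun i _ => (Finset.mem_filter.1 hp).2.1 i
    simp only [Finset.sum_const, Finset.card_univ, Fintype.card_fin, smul_eq_mul, mul_one] at h1
    rw [Finset.mem_Icc] at hk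
    omega
  · intro h
    exact absurd (Finset.mem_Icc.2 ⟨le_rfl, hn⟩) h

end BCH

/-! ### Brackets of nearly commuting elements -/

section TailBound

variable {𝔥 : Type*} [LieRing 𝔥] [LieAlgebra ℝ 𝔥]
  (V : ℕ → Submodule ℝ 𝔥) [GradedLieAlgebra V]
  (b : ∀ j, Module.Basis (Fin (Module.finrank ℝ (V j))) ℝ (V j))

/-- `x` and `y` are of size `R`, up to degree `n` they are `δ`-close to commuting horizontal
elements. -/
structure NearlyCommuting (M R δ : ℝ) (n : ℕ) (x y : 𝔥) : Prop where
  nonneg : 0 ≤ δ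
  le : δ ≤ R
  left_one : ‖coord V b 1 x‖ ≤ R
  right_one : ‖coord V b 1 y‖ ≤ R
  left : ∀ j, 1 ≤ j → j + 1 < n → ‖coord V b (j + 1) x‖ ≤ δ * R ^ j
  right : ∀ j, 1 ≤ j → j + 1 < n → ‖coord V b (j + 1) y‖ ≤ δ * R ^ j
  bracket : ‖coord V b 2 ⁅(component V 1 x : 𝔥), (component V 1 y : 𝔥)⁆‖ ≤ M * (δ * R)

variable {V b}
variable {s : ℕ} {M : ℝ}

theorem NearlyCommuting.norm_coord_le {R δ : ℝ} {n : ℕ} {x y z : 𝔥}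
    (h : NearlyCommuting V b M R δ n x y) (hz : z = x ∨ z = y) (j : ℕ) (hj : j + 1 < n) :
    ‖coord V b (j + 1) z‖ ≤ R ^ (j + 1) := by
  have hR : 0 ≤ R := h.nonneg.trans h.le
  rcases Nat.eq_zero_or_pos j with rfl | hj0
  · rcases hz with rfl | rfl
    · simpa using h.left_one
    · simpa using h.right_one
  · have h1 : δ * R ^ j ≤ R ^ (j + 1) := by
      rw [pow_succ']
      exact mul_le_mul_of_nonneg_right h.le (by positivity)
    rcases hz with rfl | rfl
    · exact (h.left j hj0 hj).trans h1
    · exact (h.right j hj0 hj).trans h1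

theorem NearlyCommuting.norm_coord_le' {R δ : ℝ} {n : ℕ} {x y z : 𝔥}
    (h : NearlyCommuting V b M R δ n x y) (hz : z = x ∨ z = y) (j : ℕ) (hj0 : 1 ≤ j)
    (hj : j + 1 < n) : ‖coord V b (j + 1) z‖ ≤ δ * R ^ j := by
  rcases hz with rfl | rfl
  · exact h.left j hj0 hj
  · exact h.right j hj0 hj

theorem NearlyCommuting.norm_bracket_le {R δ : ℝ} {n : ℕ} {x y u v : 𝔥} (hM0 : 0 ≤ M)
    (h : NearlyCommuting V b M R δ n x y) (hu : u = x ∨ u = y) (hv : v = x ∨ v = y) :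
    ‖coord V b 2 ⁅(component V 1 u : 𝔥), (component V 1 v : 𝔥)⁆‖ ≤ M * (δ * R) := by
  have hR : 0 ≤ R := h.nonneg.trans h.le
  have h0 : 0 ≤ M * (δ * R) := mul_nonneg hM0 (mul_nonneg h.nonneg hR)
  rcases hu with rfl | rfl <;> rcases hv with rfl | rfl
  · simpa [coord_zero] using h0
  · exact h.bracket
  · rw [← lie_skew, coord_neg, norm_neg]
    exact h.bracket
  · simpa [coord_zero] using h0

/-- Since `V 0` is trivial, only layers below `n` enter a bracket of degree at most `n`. The pair of
first layers is handled by the field `bracket`; in every other pair a factor from a layer of degree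
at least 2 supplies the `δ`. -/
theorem NearlyCommuting.norm_lie_le (hM0 : 0 ≤ M) (hM : BracketBound V b s M)
    (hV : V 0 = ⊥) {R δ : ℝ} {n : ℕ} (hn : n ≤ s) {x y u v : 𝔥}
    (h : NearlyCommuting V b M R δ n x y) (hu : u = x ∨ u = y) (hv : v = x ∨ v = y)
    (j : ℕ) (hj : j + 1 ≤ n) :
    ‖coord V b (j + 1) ⁅u, v⁆‖ ≤ (s + 1) * M * (δ * R ^ j) := by
  have hR : 0 ≤ R := h.nonneg.trans h.le
  have hδ := h.nonneg
  rw [coord_lie]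
  have key : ∀ p ∈ Finset.HasAntidiagonal.antidiagonal (j + 1),
      ‖coord V b (j + 1) ⁅(component V p.1 u : 𝔥), (component V p.2 v : 𝔥)⁆‖ ≤
        M * (δ * R ^ j) := by
    rintro ⟨a, c⟩ hp
    rw [Finset.HasAntidiagonal.mem_antidiagonal] at hp
    have hbd := hM (j + 1) (hj.trans hn) a c u v
    have h0 : 0 ≤ M * (δ * R ^ j) := by positivity
    rcases a with _ | a
    · rw [coord_of_eq_bot V b hV, norm_zero, zero_mul, mul_zero] at hbd
      exact hbd.trans h0
    rcases c with _ | c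
    · rw [coord_of_eq_bot V b hV, norm_zero, mul_zero, mul_zero] at hbd
      exact hbd.trans h0
    simp only at hp hbd ⊢
    rcases Nat.eq_zero_or_pos c with rfl | hc
    · rcases Nat.eq_zero_or_pos a with rfl | ha
      · obtain rfl : j = 1 := by omega
        simpa using h.norm_bracket_le hM0 hu hv
      · refine hbd.trans (mul_le_mul_of_nonneg_left ?_ hM0)
        calc _ ≤ (δ * R ^ a) * R ^ (0 + 1) :=
              mul_le_mul (h.norm_coord_le' hu a ha (by omega))
                (h.norm_coord_le hv 0 (by omega)) (norm_nonneg _) (by positivity)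
          _ = δ * R ^ j := by
              obtain rfl : j = a + 1 := by omega
              ring
    · refine hbd.trans (mul_le_mul_of_nonneg_left ?_ hM0)
      calc _ ≤ R ^ (a + 1) * (δ * R ^ c) :=
            mul_le_mul (h.norm_coord_le hu a (by omega))
              (h.norm_coord_le' hv c hc (by omega)) (norm_nonneg _) (by positivity)
        _ = δ * R ^ j := by
            obtain rfl : j = a + 1 + c := by omega
            ring
  calc _ ≤ ∑ p ∈ Finset.HasAntidiagonal.antidiagonal (j + 1), M * (δ * R ^ j) := norm_sum_le_of_le _ key
    _ = ((j + 1 : ℕ) + 1 : ℝ) * (M * (δ * R ^ j)) := by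
        rw [Finset.sum_const, Finset.Nat.card_antidiagonal, nsmul_eq_mul]
        push_cast
        rfl
    _ ≤ (s + 1) * M * (δ * R ^ j) := by
        rw [mul_assoc]
        refine mul_le_mul_of_nonneg_right ?_ (by positivity)
        have : ((j + 1 : ℕ) : ℝ) ≤ s := by exact_mod_cast hj.trans hn
        linarith

theorem NearlyCommuting.norm_lie_le_of_le (hM0 : 0 ≤ M) (hM : BracketBound V b s M)
    (hV : V 0 = ⊥) {R δ K : ℝ} (hK : 0 ≤ K) {n : ℕ} (hn : n ≤ s) {x y u w : 𝔥}
    (h : NearlyCommuting V b M R δ n x y) (hu : u = x ∨ u = y)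
    (hw : ∀ j, j + 1 ≤ n → ‖coord V b (j + 1) w‖ ≤ K * (δ * R ^ j))
    (j : ℕ) (hj : j + 1 ≤ n) :
    ‖coord V b (j + 1) ⁅u, w⁆‖ ≤ (s + 1) * M * K * (δ * R ^ j) := by
  have hR : 0 ≤ R := h.nonneg.trans h.le
  have hδ := h.nonneg
  rw [coord_lie]
  have key : ∀ p ∈ Finset.HasAntidiagonal.antidiagonal (j + 1),
      ‖coord V b (j + 1) ⁅(component V p.1 u : 𝔥), (component V p.2 w : 𝔥)⁆‖ ≤
        M * K * (δ * R ^ j) := by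
    rintro ⟨a, c⟩ hp
    rw [Finset.HasAntidiagonal.mem_antidiagonal] at hp
    have hbd := hM (j + 1) (hj.trans hn) a c u w
    have h0 : 0 ≤ M * K * (δ * R ^ j) := by positivity
    rcases a with _ | a
    · rw [coord_of_eq_bot V b hV, norm_zero, zero_mul, mul_zero] at hbd
      exact hbd.trans h0
    rcases c with _ | c
    · rw [coord_of_eq_bot V b hV, norm_zero, mul_zero, mul_zero] at hbd
      exact hbd.trans h0
    simp only at hp hbd ⊢
    rw [mul_assoc M K]
    refine hbd.trans (mul_le_mul_of_nonneg_left ?_ hM0)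
    calc _ ≤ R ^ (a + 1) * (K * (δ * R ^ c)) :=
          mul_le_mul (h.norm_coord_le hu a (by omega))
            (hw c (by omega)) (norm_nonneg _) (by positivity)
      _ = K * (δ * R ^ j) := by
          obtain rfl : j = a + 1 + c := by omega
          ring
  calc _ ≤ ∑ p ∈ Finset.HasAntidiagonal.antidiagonal (j + 1), M * K * (δ * R ^ j) := norm_sum_le_of_le _ key
    _ = ((j + 1 : ℕ) + 1 : ℝ) * (M * K * (δ * R ^ j)) := by
        rw [Finset.sum_const, Finset.Nat.card_antidiagonal, nsmul_eq_mul]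
        push_cast
        rfl
    _ ≤ (s + 1) * M * K * (δ * R ^ j) := by
        rw [mul_assoc (s + 1 : ℝ) M K, mul_assoc (s + 1 : ℝ)]
        refine mul_le_mul_of_nonneg_right ?_ (by positivity)
        have : ((j + 1 : ℕ) : ℝ) ≤ s := by exact_mod_cast hj.trans hn
        linarith

/-- The innermost bracket produces the factor `δ`; each further bracket preserves it at the cost of
a factor `(s + 1) * M`. -/
theorem NearlyCommuting.norm_nestedBracket_le (hM0 : 0 ≤ M) (hM : BracketBound V b s M)
    (hV : V 0 = ⊥) {R δ : ℝ} {n : ℕ} (hn : n ≤ s) {x y : 𝔥}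
    (h : NearlyCommuting V b M R δ n x y) :
    ∀ l : List 𝔥, 2 ≤ l.length → (∀ z ∈ l, z = x ∨ z = y) → ∀ j, j + 1 ≤ n →
      ‖coord V b (j + 1) (nestedBracket l)‖ ≤ ((s + 1) * M) ^ (l.length - 1) * (δ * R ^ j)
  | [], hl, _, _, _ => by simp at hl
  | [_], hl, _, _, _ => by simp at hl
  | [u, v], _, hz, j, hj => by
    simpa [nestedBracket] using h.norm_lie_le hM0 hM hV hn (hz u (by simp)) (hz v (by simp)) j hj
  | u :: v :: w :: l, _, hz, j, hj => by
    have ih := h.norm_nestedBracket_le hM0 hM hV hn (v :: w :: l) (by simp)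
      (fun z hz' => hz z (List.mem_cons_of_mem _ hz'))
    have := h.norm_lie_le_of_le hM0 hM hV (by positivity) hn (hz u (by simp)) ih j hj
    rw [nestedBracket]
    simpa [pow_succ'] using this

theorem exists_norm_coord_bchTail_le (hM0 : 0 ≤ M) (hM : BracketBound V b s M) (hV : V 0 = ⊥) :
    ∃ K : ℝ, 0 ≤ K ∧ ∀ (n : ℕ) (R δ : ℝ) (x y : 𝔥), n + 1 ≤ s →
      NearlyCommuting V b M R δ (n + 1) x y →
        ‖coord V b (n + 1) (bchTail s x y)‖ ≤ K * (δ * R ^ n) := by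
  refine ⟨∑ k ∈ Finset.Icc 1 s,
    ∑ p ∈ (Fintype.piFinset fun _ : Fin k => Finset.range (s + 1) ×ˢ Finset.range (s + 1)) with
        (∀ i, 0 < (p i).1 + (p i).2) ∧ ∑ i, ((p i).1 + (p i).2) ≤ s,
      |(((-1 : ℝ) ^ (k - 1) / (k : ℝ)) *
          ((∑ i, ((p i).1 + (p i).2) : ℕ) : ℝ)⁻¹ *
          ((∏ i, (p i).1 ! * (p i).2 ! : ℕ) : ℝ)⁻¹)| *
        ((s + 1) * M) ^ (∑ i, ((p i).1 + (p i).2) - 1), ?_, ?_⟩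
  · refine Finset.sum_nonneg fun k _ => Finset.sum_nonneg fun p _ => ?_
    positivity
  · intro n R δ x y hn h
    have hR : 0 ≤ R := h.nonneg.trans h.le
    have hδ := h.nonneg
    rw [bchTail, coord_sum, Finset.sum_mul]
    refine norm_sum_le_of_le _ fun k _ => ?_
    rw [coord_sum, Finset.sum_mul]
    refine norm_sum_le_of_le _ fun p _ => ?_
    rw [coord_smul, norm_smul, Real.norm_eq_abs, mul_assoc |_|]
    refine mul_le_mul_of_nonneg_left ?_ (abs_nonneg _)
    split_ifs with h2
    · rw [← length_bchWord p x y] at h2 ⊢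
      exact h.norm_nestedBracket_le hM0 hM hV hn _ h2 (fun z => eq_or_eq_of_mem_bchWord) n le_rfl
    · rw [coord_zero, norm_zero]
      positivity

end TailBound

/-! ### Convexity inequalities for real powers -/

section RealInequalities

theorem half_add_pow_le {a c : ℝ} (ha : 0 ≤ a) (hc : 0 ≤ c) (n : ℕ) :
    ((a + c) / 2) ^ (n + 1) ≤ (a ^ (n + 1) + c ^ (n + 1)) / 2 := by
  have h := add_pow_le ha hc (n + 1)
  rw [Nat.add_sub_cancel] at h
  rw [div_pow, pow_succ 2, div_le_div_iff₀ (by positivity) (by norm_num)]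
  linarith

theorem add_pow_le_two_pow_mul {u v X Y : ℝ} {p : ℕ} (hu : 0 ≤ u) (hv : 0 ≤ v)
    (hX : u ^ p ≤ X) (hY : v ^ p ≤ Y) : (u + v) ^ p ≤ 2 ^ p * (X + Y) := by
  have hX0 : 0 ≤ X := (pow_nonneg hu p).trans hX
  have hY0 : 0 ≤ Y := (pow_nonneg hv p).trans hY
  calc (u + v) ^ p ≤ 2 ^ (p - 1) * (u ^ p + v ^ p) := add_pow_le hu hv p
    _ ≤ 2 ^ p * (X + Y) := by
      gcongr
      · norm_num
      · omega

/-- The numerical core of the induction: `a`, `c`, `m` stand for `N_k ^ p` at `g`, `h`, `gh`, while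
`u`, `v`, `w` are the norms of their coordinates of degree `k + 1`, `P` is the bracket error and `l`
the new weight. Half of the convexity gain pays for `l * P ^ p`. -/
theorem pow_convexity_gain {k p : ℕ} (hk : 1 ≤ k) (hp : 1 ≤ p) {a c m u v w P l B : ℝ}
    (ha : 0 ≤ a) (hc : 0 ≤ c) (hm : 0 ≤ m) (hu : 0 ≤ u) (hv : 0 ≤ v) (hw : 0 ≤ w) (hP : 0 ≤ P)
    (hl : 0 ≤ l) (hS : 0 ≤ (a + c) / 2 - m / 2 ^ p) (hwP : w ≤ u + v + P)
    (hB : P ^ p ≤ B * (((a + c) / 2 - m / 2 ^ p) * ((a + c) / 2) ^ k)) (hlB : 2 * (l * B) ≤ 1) :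
    ((a + c) / 2 - m / 2 ^ p) * ((a + c) / 2) ^ k / 2 + l / 4 * (u ^ p + v ^ p) ≤
      ((a ^ (k + 1) + l * u ^ p) + (c ^ (k + 1) + l * v ^ p)) / 2 -
        (m ^ (k + 1) + l * w ^ p) / 2 ^ (p * (k + 1)) := by
  set T := (a + c) / 2 with hT
  set d := m / 2 ^ p with hd
  have hT0 : 0 ≤ T := by positivity
  have hd0 : 0 ≤ d := by positivity
  have hdT : d ≤ T := sub_nonneg.1 hS
  have h1 : T ^ (k + 1) ≤ (a ^ (k + 1) + c ^ (k + 1)) / 2 := half_add_pow_le ha hc k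
  have h2 : (T - d) * T ^ k ≤ T ^ (k + 1) - d ^ (k + 1) := by
    have : d * d ^ k ≤ d * T ^ k := by gcongr
    rw [pow_succ', pow_succ']
    linarith
  have h3 : m ^ (k + 1) / 2 ^ (p * (k + 1)) = d ^ (k + 1) := by rw [hd, div_pow, pow_mul]
  have hq : (2 : ℝ) ^ (p - 1) = 2 ^ p / 2 := by
    obtain ⟨r, rfl⟩ : ∃ r, p = r + 1 := ⟨p - 1, by omega⟩
    rw [Nat.add_sub_cancel, pow_succ]
    ring
  have hq1 : (1 : ℝ) ≤ 2 ^ p := one_le_pow₀ (by norm_num)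
  have hwp : w ^ p ≤ 2 ^ p / 2 * (2 ^ p / 2 * (u ^ p + v ^ p) + P ^ p) := by
    rw [← hq]
    calc w ^ p ≤ (u + v + P) ^ p := by gcongr
      _ ≤ 2 ^ (p - 1) * ((u + v) ^ p + P ^ p) := add_pow_le (by positivity) hP p
      _ ≤ _ := by
        gcongr
        exact add_pow_le hu hv p
  -- Here `k ≥ 1` matters: the extra factor `2 ^ p` brings the coefficient of `u ^ p + v ^ p` down
  -- to `1 / 4`, strictly below the available `1 / 2`.
  have hpow : (2 : ℝ) ^ p * 2 ^ p ≤ 2 ^ (p * (k + 1)) := by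
    rw [← pow_add]
    exact pow_le_pow_right₀ (by norm_num) (by nlinarith)
  have h4 : w ^ p / 2 ^ (p * (k + 1)) ≤ (u ^ p + v ^ p) / 4 + P ^ p := by
    rw [div_le_iff₀ (by positivity)]
    have hnn : 0 ≤ (u ^ p + v ^ p) / 4 + P ^ p := by positivity
    calc w ^ p ≤ 2 ^ p / 2 * (2 ^ p / 2 * (u ^ p + v ^ p) + P ^ p) := hwp
      _ ≤ ((u ^ p + v ^ p) / 4 + P ^ p) * (2 ^ p * 2 ^ p) := by
        have hPp : 0 ≤ P ^ p := by positivity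
        have : 2 ^ p * P ^ p ≤ 2 ^ p * (2 ^ p * P ^ p) := by
          gcongr
          exact le_mul_of_one_le_left hPp hq1
        have h0 : 0 ≤ 2 ^ p * P ^ p := by positivity
        nlinarith
      _ ≤ _ := by gcongr
  have h5 : l * (w ^ p / 2 ^ (p * (k + 1))) ≤ l * ((u ^ p + v ^ p) / 4 + P ^ p) := by gcongr
  have h6 : l * P ^ p ≤ (T - d) * T ^ k / 2 := by
    have hX : 0 ≤ (T - d) * T ^ k := by positivity
    calc l * P ^ p ≤ l * (B * ((T - d) * T ^ k)) := by gcongr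
      _ = (l * B) * ((T - d) * T ^ k) := by ring
      _ ≤ 1 / 2 * ((T - d) * T ^ k) := by
        gcongr
        linarith
      _ = _ := by ring
  rw [add_div (m ^ (k + 1)), h3, mul_div_assoc l (w ^ p)]
  linarith

end RealInequalities

/-! ### Powers of the norms, and pairs close to a horizontal element -/

section NormPow

variable {𝔥 : Type*} [LieRing 𝔥] [LieAlgebra ℝ 𝔥]
  (V : ℕ → Submodule ℝ 𝔥) [GradedLieAlgebra V]
  (b : ∀ j, Module.Basis (Fin (Module.finrank ℝ (V j))) ℝ (V j))
  {lam : ℕ → ℝ}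

theorem groupNorm_nonneg (hl : ∀ j, 0 ≤ lam j) : ∀ (k : ℕ) (x : 𝔥), 0 ≤ groupNorm V b lam k x
  | 0, _ => le_rfl
  | 1, _ => norm_nonneg _
  | k + 2, x => by
    have := groupNorm_nonneg hl (k + 1) x
    have := hl (k + 2)
    rw [groupNorm]
    positivity

theorem groupNorm_congr {lam' : ℕ → ℝ} (x : 𝔥) :
    ∀ k : ℕ, (∀ j ≤ k, lam j = lam' j) → groupNorm V b lam k x = groupNorm V b lam' k x
  | 0, _ => rfl
  | 1, _ => rfl
  | k + 2, h => by
    rw [groupNorm, groupNorm, groupNorm_congr x (k + 1) fun j hj => h j (by omega),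
      h (k + 2) le_rfl]

/-- The power `N_k ^ (2 k!)` of the norm `N_k`. -/
noncomputable def normPow (lam : ℕ → ℝ) (k : ℕ) (x : 𝔥) : ℝ := groupNorm V b lam k x ^ (2 * k !)

theorem normPow_nonneg (hl : ∀ j, 0 ≤ lam j) (k : ℕ) (x : 𝔥) : 0 ≤ normPow V b lam k x :=
  pow_nonneg (groupNorm_nonneg V b hl k x) _

theorem normPow_one (x : 𝔥) : normPow V b lam 1 x = ‖coord V b 1 x‖ ^ 2 := rfl

/-- The power cancels the root in `groupNorm`, so from here on the recursion involves natural
exponents only. -/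
theorem normPow_succ (hl : ∀ j, 0 ≤ lam j) {k : ℕ} (hk : 1 ≤ k) (x : 𝔥) :
    normPow V b lam (k + 1) x =
      normPow V b lam k x ^ (k + 1) + lam (k + 1) * ‖coord V b (k + 1) x‖ ^ (2 * k !) := by
  obtain ⟨k, rfl⟩ : ∃ r, k = r + 1 := ⟨k - 1, by omega⟩
  have h1 := groupNorm_nonneg V b hl (k + 1) x
  have h2 := hl (k + 2)
  have e : (1 / (2 * ((k + 2)! : ℝ))) = ((2 * (k + 2)! : ℕ) : ℝ)⁻¹ := by
    push_cast
    rw [one_div]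
  rw [normPow, groupNorm, e, Real.rpow_inv_natCast_pow (by positivity)
    (by have := (k + 2).factorial_pos; omega), normPow, ← pow_mul]
  congr 2
  rw [Nat.factorial_succ (k + 1)]
  ring

theorem norm_coord_one_pow_le (hl : ∀ j, 0 ≤ lam j) (x : 𝔥) {k : ℕ} (hk : 1 ≤ k) :
    ‖coord V b 1 x‖ ^ (2 * k !) ≤ normPow V b lam k x := by
  induction k, hk using Nat.le_induction with
  | base => exact le_rfl
  | succ k hk ih =>
    rw [normPow_succ V b hl hk, Nat.factorial_succ, mul_left_comm, mul_comm, pow_mul]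
    have := hl (k + 1)
    have h1 : (‖coord V b 1 x‖ ^ (2 * k !)) ^ (k + 1) ≤ normPow V b lam k x ^ (k + 1) := by gcongr
    have h2 : 0 ≤ lam (k + 1) * ‖coord V b (k + 1) x‖ ^ (2 * k !) := by positivity
    linarith

/-- The defect in the inequality
`(N_k (g h) / 2) ^ (2 k!) ≤ (N_k g ^ (2 k!) + N_k h ^ (2 k!)) / 2`. -/
noncomputable def convexityDefect (lam : ℕ → ℝ) (s k : ℕ) (g h : 𝔥) : ℝ :=
  (normPow V b lam k g + normPow V b lam k h) / 2 - normPow V b lam k (bch s g h) / 2 ^ (2 * k !)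

/-- The product `π(x)⁻¹ x`. -/
noncomputable def vertical (s : ℕ) (x : 𝔥) : 𝔥 := bch s (-horizontal V x) x

/-- A radius `δ` such that `g` and `h` are `δ`-close to a common horizontal element, as far as
coordinates of degree at most `k` are concerned. -/
structure HorizontalWithin (s k : ℕ) (δ : ℝ) (g h : 𝔥) : Prop where
  nonneg : 0 ≤ δ
  sub_one : ‖coord V b 1 g - coord V b 1 h‖ ≤ δ
  left : ∀ j, 1 ≤ j → j + 1 ≤ k → ‖coord V b (j + 1) g‖ ≤ δ ^ (j + 1)
  right : ∀ j, 1 ≤ j → j + 1 ≤ k → ‖coord V b (j + 1) h‖ ≤ δ ^ (j + 1)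
  mul : ∀ j, 1 ≤ j → j + 1 ≤ k → ‖coord V b (j + 1) (bch s g h)‖ ≤ δ ^ (j + 1)
  vertical : ∀ j, 1 ≤ j → j + 1 ≤ k →
    ‖coord V b (j + 1) (vertical V s (bch s g h))‖ ≤ δ ^ (j + 1)

variable {V b}

theorem coord_one_lie (hV : V 0 = ⊥) (x y : 𝔥) : coord V b 1 ⁅x, y⁆ = 0 := by
  have h0 : ∀ x : 𝔥, component V 0 x = 0 := fun x =>
    Subtype.ext ((Submodule.mem_bot ℝ).1 (hV ▸ (component V 0 x).2))
  rw [coord_lie]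
  refine Finset.sum_eq_zero ?_
  rintro ⟨i, j⟩ hp
  rw [Finset.HasAntidiagonal.mem_antidiagonal] at hp
  simp only at hp
  have : i = 0 ∨ j = 0 := by omega
  rcases this with rfl | rfl <;> simp [h0, coord_zero]

theorem coord_one_bchTail (hV : V 0 = ⊥) (n : ℕ) (x y : 𝔥) : coord V b 1 (bchTail n x y) = 0 := by
  rw [bchTail, coord_sum]
  refine Finset.sum_eq_zero fun k _ => ?_
  rw [coord_sum]
  refine Finset.sum_eq_zero fun p _ => ?_
  rw [coord_smul]
  split_ifs with h
  · rw [← length_bchWord p x y] at h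
    rcases hl : bchWord p x y with _ | ⟨u, _ | ⟨v, l⟩⟩
    · simp [hl] at h
    · simp [hl] at h
    · rw [nestedBracket, coord_one_lie hV, smul_zero]
  · rw [coord_zero, smul_zero]

theorem coord_one_bch (hV : V 0 = ⊥) {s : ℕ} (hs : 1 ≤ s) (x y : 𝔥) :
    coord V b 1 (bch s x y) = coord V b 1 x + coord V b 1 y := by
  rw [bch_eq_add_tail hs, coord_add, coord_one_bchTail hV, add_zero, coord_add]

theorem coord_one_horizontal (x : 𝔥) : coord V b 1 (horizontal V x) = coord V b 1 x :=
  coord_component_same V b 1 x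

theorem coord_horizontal (x : 𝔥) {j : ℕ} (hj : 1 ≤ j) : coord V b (j + 1) (horizontal V x) = 0 :=
  coord_of_mem_ne V b (component V 1 x).2 (by omega)

theorem coord_one_vertical (hV : V 0 = ⊥) {s : ℕ} (hs : 1 ≤ s) (x : 𝔥) :
    coord V b 1 (vertical V s x) = 0 := by
  rw [vertical, coord_one_bch hV hs, coord_neg, coord_one_horizontal, neg_add_cancel]

theorem HorizontalWithin.nearlyCommuting {s k : ℕ} {M δ R : ℝ} {g h : 𝔥} (hM0 : 0 ≤ M)
    (hM : BracketBound V b s M) (hk : 1 ≤ k) (hks : k + 1 ≤ s)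
    (H : HorizontalWithin V b s k δ g h) (hδR : δ ≤ R) (hg : ‖coord V b 1 g‖ ≤ R)
    (hh : ‖coord V b 1 h‖ ≤ R) : NearlyCommuting V b M R δ (k + 1) g h where
  nonneg := H.nonneg
  le := hδR
  left_one := hg
  right_one := hh
  left j hj hjk := by
    refine (H.left j hj (by omega)).trans ?_
    have := H.nonneg
    rw [pow_succ']
    gcongr
  right j hj hjk := by
    refine (H.right j hj (by omega)).trans ?_
    have := H.nonneg
    rw [pow_succ']
    gcongr
  bracket := by
    -- Subtracting `⁅h₁, h₁⁆ = 0` exposes the small factor `g₁ - h₁`.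
    have e : ⁅(component V 1 g : 𝔥), (component V 1 h : 𝔥)⁆ =
        ⁅(component V 1 (g - h) : 𝔥), (component V 1 h : 𝔥)⁆ := by
      rw [sub_eq_add_neg, component_add, component_neg]
      simp
    rw [e]
    refine (hM 2 (by omega) 1 1 _ _).trans (mul_le_mul_of_nonneg_left ?_ hM0)
    rw [coord_sub]
    exact mul_le_mul H.sub_one hh (norm_nonneg _) H.nonneg

/-- The two first layers are opposite, so they commute exactly; the radius doubles because the first
layer of `gh` is `g₁ + h₁`. -/
theorem HorizontalWithin.nearlyCommuting_horizontal {s k : ℕ} {M δ R : ℝ} {g h : 𝔥} (hM0 : 0 ≤ M)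
    (hV : V 0 = ⊥) (hs : 1 ≤ s)
    (H : HorizontalWithin V b s k δ g h) (hδR : δ ≤ R) (hg : ‖coord V b 1 g‖ ≤ R)
    (hh : ‖coord V b 1 h‖ ≤ R) :
    NearlyCommuting V b M (2 * R) δ (k + 1) (-horizontal V (bch s g h)) (bch s g h) := by
  have hδ := H.nonneg
  have hR : 0 ≤ R := hδ.trans hδR
  have h1 : ‖coord V b 1 (bch s g h)‖ ≤ 2 * R := by
    rw [coord_one_bch hV hs]
    exact (norm_add_le _ _).trans (by linarith)
  refine ⟨hδ, by linarith, ?_, h1, fun j hj hjk => ?_, fun j hj hjk => ?_, ?_⟩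
  · rwa [coord_neg, norm_neg, coord_one_horizontal]
  · rw [coord_neg, coord_horizontal _ hj, neg_zero, norm_zero]
    positivity
  · refine (H.mul j hj (by omega)).trans ?_
    rw [pow_succ']
    gcongr
    linarith
  · have : component V 1 (horizontal V (bch s g h)) = component V 1 (bch s g h) :=
      component_coe_same V 1 _
    rw [component_neg, this]
    simp only [NegMemClass.coe_neg, neg_lie, lie_self, neg_zero, coord_zero, norm_zero]
    positivity

end NormPow

/-! ### Induction on the layers -/

section Induction

variable {𝔥 : Type*} [LieRing 𝔥] [LieAlgebra ℝ 𝔥]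
  {V : ℕ → Submodule ℝ 𝔥} [GradedLieAlgebra V]
  {b : ∀ j, Module.Basis (Fin (Module.finrank ℝ (V j))) ℝ (V j)}
  {lam : ℕ → ℝ}

variable (V b) in
/-- The defect of `N_k` controls the distance of a pair to a common horizontal element. -/
def DefectControls (lam : ℕ → ℝ) (s k : ℕ) (A : ℝ) : Prop :=
  ∀ g h : 𝔥, ∃ δ, HorizontalWithin V b s k δ g h ∧
    δ ^ (2 * k !) ≤ A * convexityDefect V b lam s k g h

theorem normPow_congr {lam' : ℕ → ℝ} {k : ℕ} (h : ∀ j ≤ k, lam j = lam' j) (x : 𝔥) :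
    normPow V b lam k x = normPow V b lam' k x := by
  rw [normPow, normPow, groupNorm_congr V b x k h]

theorem DefectControls.defect_nonneg {s k : ℕ} {A : ℝ} (hA : 0 < A)
    (H : DefectControls V b lam s k A) (g h : 𝔥) : 0 ≤ convexityDefect V b lam s k g h := by
  obtain ⟨δ, h1, h2⟩ := H g h
  have : 0 ≤ A * convexityDefect V b lam s k g h := (pow_nonneg h1.nonneg _).trans h2
  exact nonneg_of_mul_nonneg_right this hA

/-- By the parallelogram law the defect equals `|g₁ - h₁| ^ 2 / 4`; the conditions on higher layers
are vacuous. -/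
theorem defectControls_one (hV : V 0 = ⊥) {s : ℕ} (hs : 1 ≤ s) :
    DefectControls V b lam s 1 4 := by
  intro g h
  refine ⟨‖coord V b 1 g - coord V b 1 h‖, ⟨norm_nonneg _, le_rfl, ?_, ?_, ?_, ?_⟩, ?_⟩
  iterate 4 exact fun j hj hj1 => absurd hj1 (by omega)
  rw [convexityDefect, normPow_one, normPow_one, normPow_one, coord_one_bch hV hs]
  have := parallelogram_law_with_norm ℝ (coord V b 1 g) (coord V b 1 h)
  simp only [Nat.factorial_one, mul_one]
  linarith

/-- The part of the product of degree `k + 1` that is not linear is controlled by the defect of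
`N_k`. -/
theorem DefectControls.exists_tail_le {s k : ℕ} {A : ℝ} (hV : ∀ j, j = 0 ∨ s < j → V j = ⊥)
    (hl : ∀ j, 0 ≤ lam j) (hA : 0 < A) (hk : 1 ≤ k) (hks : k + 1 ≤ s)
    (H : DefectControls V b lam s k A) :
    ∃ B : ℝ, 0 ≤ B ∧ ∀ g h : 𝔥,
      let X := convexityDefect V b lam s k g h *
        ((normPow V b lam k g + normPow V b lam k h) / 2) ^ k
      ‖coord V b (k + 1) (bchTail s g h)‖ ^ (2 * k !) ≤ B * X ∧
      ‖coord V b (k + 1) (bchTail s (-horizontal V (bch s g h)) (bch s g h))‖ ^ (2 * k !) ≤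
        B * X := by
  have hV0 : V 0 = ⊥ := hV 0 (Or.inl rfl)
  obtain ⟨M, hM0, hM⟩ := exists_bracketBound V b s hV
  obtain ⟨K, hK0, hK⟩ := exists_norm_coord_bchTail_le hM0 hM hV0
  set p := 2 * k ! with hp
  refine ⟨K ^ p * A * (2 ^ p * (2 + A)) ^ k, by positivity, fun g h => ?_⟩
  intro X
  set S := convexityDefect V b lam s k g h with hS
  set T := (normPow V b lam k g + normPow V b lam k h) / 2 with hT
  have hS0 : 0 ≤ S := H.defect_nonneg hA g h
  have hng := normPow_nonneg V b hl k g
  have hnh := normPow_nonneg V b hl k h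
  have hT0 : 0 ≤ T := by positivity
  have hST : S ≤ T := by
    have := normPow_nonneg V b hl k (bch s g h)
    rw [hS, hT, convexityDefect]
    exact sub_le_self _ (by positivity)
  obtain ⟨δ, hw, hδp⟩ := H g h
  have hδ := hw.nonneg
  -- The first layers are bounded by `2 * T` in `p`-th power, and `δ ^ p ≤ A * S ≤ A * T`.
  obtain ⟨R, hδR, hgR, hhR, hRp⟩ : ∃ R, δ ≤ R ∧ ‖coord V b 1 g‖ ≤ R ∧ ‖coord V b 1 h‖ ≤ R ∧
      R ^ p ≤ (2 + A) * T := by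
    refine ⟨max δ (max ‖coord V b 1 g‖ ‖coord V b 1 h‖), le_max_left _ _,
      (le_max_left _ _).trans (le_max_right _ _), (le_max_right _ _).trans (le_max_right _ _), ?_⟩
    have h1 : A * S ≤ A * T := by gcongr
    have h2 := norm_coord_one_pow_le V b hl g hk
    have h3 := norm_coord_one_pow_le V b hl h hk
    have hAT : 0 ≤ A * T := by positivity
    have h4 : (2 + A) * T = normPow V b lam k g + normPow V b lam k h + A * T := by
      rw [hT]
      ring
    rw [h4]
    rcases max_choice δ (max ‖coord V b 1 g‖ ‖coord V b 1 h‖) with e | e <;> rw [e]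
    · linarith
    · rcases max_choice ‖coord V b 1 g‖ ‖coord V b 1 h‖ with e | e <;> rw [e] <;> linarith
  have hR : 0 ≤ R := hδ.trans hδR
  -- One factor `δ ^ p` becomes `S` and the `k` factors `R ^ p` become `T ^ k`. The radius `2 * R`
  -- serves both tails.
  have key : ∀ t : ℝ, t ≤ K * (δ * (2 * R) ^ k) → 0 ≤ t →
      t ^ p ≤ K ^ p * A * (2 ^ p * (2 + A)) ^ k * X := by
    intro t ht ht0
    calc t ^ p ≤ (K * (δ * (2 * R) ^ k)) ^ p := by gcongr
      _ = K ^ p * (δ ^ p * (2 ^ p * R ^ p) ^ k) := by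
        rw [mul_pow, mul_pow, ← mul_pow 2 R p, ← pow_mul, ← pow_mul, mul_comm k p]
      _ ≤ K ^ p * ((A * S) * (2 ^ p * ((2 + A) * T)) ^ k) := by gcongr
      _ = _ := by
        simp only [X, mul_pow]
        ring
  constructor
  · refine key _ ((hK k R δ g h hks (hw.nearlyCommuting hM0 hM hk hks hδR hgR hhR)).trans ?_)
      (norm_nonneg _)
    gcongr
    linarith
  · exact key _ (hK k (2 * R) δ _ _ hks
      (hw.nearlyCommuting_horizontal hM0 hV0 (by omega) hδR hgR hhR)) (norm_nonneg _)

theorem DefectControls.exists_succ {s k : ℕ} {A : ℝ} (hV : ∀ j, j = 0 ∨ s < j → V j = ⊥)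
    (hl : ∀ j, 0 < lam j) (hA : 0 < A) (hk : 1 ≤ k) (hks : k + 1 ≤ s)
    (H : DefectControls V b lam s k A) :
    ∃ lam' : ℕ → ℝ, (∀ j, 0 < lam' j) ∧ ∃ A', 0 < A' ∧ DefectControls V b lam' s (k + 1) A' := by
  have hs : 1 ≤ s := by omega
  obtain ⟨B, hB0, hB⟩ := H.exists_tail_le hV (fun j => (hl j).le) hA hk hks
  -- Small enough that `l * B ≤ 1 / 2`; `B + 1` avoids division by zero. Changing the weight of
  -- index `k + 1` leaves `N_k` untouched.
  set l : ℝ := 1 / (2 * (B + 1)) with hldef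
  have hl0 : 0 < l := by positivity
  have hlB : 2 * (l * B) ≤ 1 := by
    rw [hldef, one_div, ← mul_assoc, mul_comm 2, mul_assoc, inv_mul_le_one₀ (by positivity)]
    linarith
  set lam' := Function.update lam (k + 1) l with hlam'
  have hagree : ∀ j ≤ k, lam j = lam' j := fun j hj => by
    rw [hlam', Function.update_of_ne (by omega)]
  have hlam'k : lam' (k + 1) = l := by rw [hlam', Function.update_self]
  have hl' : ∀ j, 0 < lam' j := fun j => by
    by_cases hj : j = k + 1
    · rwa [hj, hlam'k]
    · rw [hlam', Function.update_of_ne hj]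
      exact hl j
  have hl'0 : ∀ j, 0 ≤ lam' j := fun j => (hl' j).le
  set p := 2 * k ! with hp
  have hp1 : 1 ≤ p := by
    have := k.factorial_pos
    omega
  have hfac : 2 * (k + 1)! = p * (k + 1) := by
    rw [hp, Nat.factorial_succ]
    ring
  set c₁ : ℝ := 4 / l
  set c₂ : ℝ := 2 ^ p * (2 ^ p * (c₁ + c₁) + 2 * B)
  set c₃ : ℝ := 2 ^ p * (c₂ + 2 * B)
  -- The summands pay respectively for the old radius `δ` and for the new layer of `g` and `h`, of
  -- `gh`, and of the vertical part of `gh`.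
  refine ⟨lam', hl', 2 * A ^ (k + 1) + c₁ + c₂ + c₃, by positivity, fun g h => ?_⟩
  set x := bch s g h with hx
  set S := convexityDefect V b lam s k g h with hS
  set T := (normPow V b lam k g + normPow V b lam k h) / 2 with hT
  set D := convexityDefect V b lam' s (k + 1) g h with hD
  have hS0 : 0 ≤ S := H.defect_nonneg hA g h
  have hng := normPow_nonneg V b (fun j => (hl j).le) k g
  have hnh := normPow_nonneg V b (fun j => (hl j).le) k h
  have hnx := normPow_nonneg V b (fun j => (hl j).le) k x
  have hT0 : 0 ≤ T := by positivity
  have hST : S ≤ T := by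
    rw [hS, hT, convexityDefect]
    exact sub_le_self _ (by positivity)
  obtain ⟨hP, hQ⟩ := hB g h
  simp only [← hS, ← hT, ← hx] at hP hQ
  have hxP : ‖coord V b (k + 1) x‖ ≤ ‖coord V b (k + 1) g‖ + ‖coord V b (k + 1) h‖ +
      ‖coord V b (k + 1) (bchTail s g h)‖ := by
    rw [hx, bch_eq_add_tail hs, coord_add, coord_add]
    exact norm_add₃_le
  have hyQ : ‖coord V b (k + 1) (vertical V s x)‖ ≤ ‖coord V b (k + 1) x‖ +
      ‖coord V b (k + 1) (bchTail s (-horizontal V x) x)‖ := by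
    rw [vertical, bch_eq_add_tail hs, coord_add, coord_add, coord_neg, coord_horizontal x hk,
      neg_zero, zero_add]
    exact norm_add_le _ _
  have hgain : S * T ^ k / 2 +
      l / 4 * (‖coord V b (k + 1) g‖ ^ p + ‖coord V b (k + 1) h‖ ^ p) ≤ D := by
    have := pow_convexity_gain hk hp1 hng hnh hnx (norm_nonneg _) (norm_nonneg _) (norm_nonneg _)
      (norm_nonneg _) hl0.le hS0 hxP hP hlB
    rw [hD, convexityDefect, normPow_succ V b hl'0 hk, normPow_succ V b hl'0 hk,
      normPow_succ V b hl'0 hk, hlam'k, hfac, ← normPow_congr hagree, ← normPow_congr hagree,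
      ← normPow_congr hagree]
    exact this
  have hST0 : 0 ≤ S * T ^ k := by positivity
  have hgp : 0 ≤ ‖coord V b (k + 1) g‖ ^ p := by positivity
  have hhp : 0 ≤ ‖coord V b (k + 1) h‖ ^ p := by positivity
  have hSD : S * T ^ k ≤ 2 * D := by
    have : 0 ≤ l / 4 * (‖coord V b (k + 1) g‖ ^ p + ‖coord V b (k + 1) h‖ ^ p) := by positivity
    linarith
  have hD0 : 0 ≤ D := by linarith
  have hsum : ‖coord V b (k + 1) g‖ ^ p + ‖coord V b (k + 1) h‖ ^ p ≤ c₁ * D := by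
    rw [show c₁ * D = D / (l / 4) by simp only [c₁]; field_simp, le_div_iff₀ (by positivity)]
    linarith
  have hg : ‖coord V b (k + 1) g‖ ^ p ≤ c₁ * D := by linarith
  have hh : ‖coord V b (k + 1) h‖ ^ p ≤ c₁ * D := by linarith
  have hBD : B * (S * T ^ k) ≤ 2 * B * D := by
    calc B * (S * T ^ k) ≤ B * (2 * D) := by gcongr
      _ = _ := by ring
  have hxD : ‖coord V b (k + 1) x‖ ^ p ≤ c₂ * D := by
    calc _ ≤ (‖coord V b (k + 1) g‖ + ‖coord V b (k + 1) h‖ +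
          ‖coord V b (k + 1) (bchTail s g h)‖) ^ p := by gcongr
      _ ≤ 2 ^ p * (2 ^ p * (c₁ * D + c₁ * D) + 2 * B * D) :=
        add_pow_le_two_pow_mul (by positivity) (norm_nonneg _)
          (add_pow_le_two_pow_mul (norm_nonneg _) (norm_nonneg _) hg hh) (hP.trans hBD)
      _ = _ := by
        simp only [c₂]
        ring
  have hyD : ‖coord V b (k + 1) (vertical V s x)‖ ^ p ≤ c₃ * D := by
    calc _ ≤ (‖coord V b (k + 1) x‖ +
          ‖coord V b (k + 1) (bchTail s (-horizontal V x) x)‖) ^ p := by gcongr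
      _ ≤ 2 ^ p * (c₂ * D + 2 * B * D) :=
        add_pow_le_two_pow_mul (norm_nonneg _) (norm_nonneg _) hxD (hQ.trans hBD)
      _ = _ := by
        simp only [c₃]
        ring
  obtain ⟨δ, hw, hδp⟩ := H g h
  have hδ := hw.nonneg
  have hc₁ : 0 ≤ c₁ * D := by positivity
  have hc₂ : 0 ≤ c₂ * D := by positivity
  have hc₃ : 0 ≤ c₃ * D := by positivity
  have hAD : 0 ≤ 2 * A ^ (k + 1) * D := by positivity
  set E := (2 * A ^ (k + 1) + c₁ + c₂ + c₃) * D with hE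
  have hEeq : E = 2 * A ^ (k + 1) * D + c₁ * D + c₂ * D + c₃ * D := by
    rw [hE]
    ring
  have hE0 : 0 ≤ E := by linarith
  -- Since `S ≤ T`, the power `S ^ (k + 1)` is at most the gain `S * T ^ k`, which the new defect
  -- bounds.
  have hδE : δ ^ (p * (k + 1)) ≤ E := by
    calc δ ^ (p * (k + 1)) = (δ ^ p) ^ (k + 1) := pow_mul _ _ _
      _ ≤ (A * S) ^ (k + 1) := by gcongr
      _ = A ^ (k + 1) * (S * S ^ k) := by rw [mul_pow, pow_succ' S]
      _ ≤ A ^ (k + 1) * (S * T ^ k) := by gcongr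
      _ ≤ A ^ (k + 1) * (2 * D) := by gcongr
      _ ≤ E := by linarith
  have hpk : p * (k + 1) ≠ 0 := by positivity
  -- The new radius is the root of `E`: it dominates `δ`, hence all old layers, and `t ^ p ≤ E`
  -- means `t ≤ ε ^ (k + 1)`, the right scaling for degree `k + 1`.
  obtain ⟨ε, hε0, hεE⟩ : ∃ ε : ℝ, 0 ≤ ε ∧ ε ^ (p * (k + 1)) = E :=
    ⟨E ^ (((p * (k + 1) : ℕ) : ℝ)⁻¹), by positivity, Real.rpow_inv_natCast_pow hE0 hpk⟩
  have hδε : δ ≤ ε := le_of_pow_le_pow_left₀ hpk hε0 (by rwa [hεE])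
  have top : ∀ t : ℝ, t ^ p ≤ E → t ≤ ε ^ (k + 1) := fun t ht =>
    le_of_pow_le_pow_left₀ (by omega : p ≠ 0) (by positivity)
      (by rwa [← pow_mul, mul_comm (k + 1) p, hεE])
  have low : ∀ (j : ℕ) (t : ℝ), t ≤ δ ^ (j + 1) → t ≤ ε ^ (j + 1) := fun j t ht =>
    ht.trans (by gcongr)
  refine ⟨ε, ⟨hε0, hw.sub_one.trans hδε, fun j hj hjk => ?_, fun j hj hjk => ?_,
    fun j hj hjk => ?_, fun j hj hjk => ?_⟩, by rw [hfac, hεE]⟩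
  all_goals
    obtain rfl | hlt : j = k ∨ j + 1 ≤ k := by omega
  · exact top _ (by linarith)
  · exact low _ _ (hw.left j hj hlt)
  · exact top _ (by linarith)
  · exact low _ _ (hw.right j hj hlt)
  · exact top _ (by linarith)
  · exact low _ _ (hw.mul j hj hlt)
  · exact top _ (by linarith)
  · exact low _ _ (hw.vertical j hj hlt)

variable (b) in
theorem exists_defectControls {s : ℕ} (hV : ∀ j, j = 0 ∨ s < j → V j = ⊥) {k : ℕ} (hk : 1 ≤ k)
    (hks : k ≤ s) :
    ∃ lam : ℕ → ℝ, (∀ j, 0 < lam j) ∧ ∃ A, 0 < A ∧ DefectControls V b lam s k A := by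
  induction k, hk using Nat.le_induction with
  | base => exact ⟨fun _ => 1, fun _ => one_pos, 4, by norm_num,
      defectControls_one (hV 0 (Or.inl rfl)) hks⟩
  | succ k hk ih =>
    obtain ⟨lam, hl, A, hA, H⟩ := ih (by omega)
    exact H.exists_succ hV hl hA hk hks

end Induction

/-! ### The quasi-norm properties -/

section QuasiNorm

variable {𝔥 : Type*} [LieRing 𝔥] [LieAlgebra ℝ 𝔥]
  {V : ℕ → Submodule ℝ 𝔥} [GradedLieAlgebra V]
  {b : ∀ j, Module.Basis (Fin (Module.finrank ℝ (V j))) ℝ (V j)}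
  {lam : ℕ → ℝ}

variable (V b) in
-- Turns the layerwise bounds on the vertical part of `gh` into a bound on `NH (gh)`.
theorem exists_normPow_le (hl : ∀ j, 0 ≤ lam j) {k : ℕ} (hk : 1 ≤ k) :
    ∃ C : ℝ, 0 ≤ C ∧ ∀ (x : 𝔥) (δ : ℝ), 0 ≤ δ →
      (∀ j, j + 1 ≤ k → ‖coord V b (j + 1) x‖ ≤ δ ^ (j + 1)) →
        normPow V b lam k x ≤ C * δ ^ (2 * k !) := by
  induction k, hk using Nat.le_induction with
  | base =>
    refine ⟨1, zero_le_one, fun x δ hδ h => ?_⟩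
    have := h 0 le_rfl
    rw [zero_add, pow_one] at this
    rw [normPow_one, one_mul, Nat.factorial_one, mul_one]
    gcongr
  | succ k hk ih =>
    obtain ⟨C, hC0, hC⟩ := ih
    have hlk := hl (k + 1)
    refine ⟨C ^ (k + 1) + lam (k + 1), by positivity, fun x δ hδ h => ?_⟩
    have h1 := hC x δ hδ fun j hj => h j (by omega)
    have h2 := h k le_rfl
    have h0 := normPow_nonneg V b hl k x
    rw [normPow_succ V b hl hk]
    calc _ ≤ (C * δ ^ (2 * k !)) ^ (k + 1) + lam (k + 1) * (δ ^ (k + 1)) ^ (2 * k !) := by gcongr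
      _ = _ := by
        have e : 2 * (k + 1)! = 2 * k ! * (k + 1) := by
          rw [Nat.factorial_succ]
          ring
        rw [e, mul_pow, ← pow_mul, ← pow_mul, mul_comm (k + 1) (2 * k !)]
        ring

variable (V b) in
theorem continuous_groupNorm [FiniteDimensional ℝ 𝔥] [TopologicalSpace 𝔥]
    [IsTopologicalAddGroup 𝔥] [ContinuousSMul ℝ 𝔥] [T2Space 𝔥] :
    ∀ k, Continuous (groupNorm V b lam k) := by
  have hc : ∀ j, Continuous fun x => ‖coord V b j x‖ := fun j =>
    ((coordₗ V b j).continuous_of_finiteDimensional).norm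
  intro k
  induction k using Nat.strong_induction_on with
  | _ k ih =>
    match k, ih with
    | 0, _ => exact continuous_const
    | 1, _ => exact hc 1
    | k + 2, ih =>
      refine Continuous.rpow_const ?_ fun x => Or.inr (by positivity)
      exact ((ih (k + 1) (by omega)).pow _).add (continuous_const.mul ((hc (k + 2)).pow _))

theorem groupNorm_eq_of_norm_coord_eq (x y : 𝔥) (h : ∀ j, ‖coord V b j x‖ = ‖coord V b j y‖) :
    ∀ k, groupNorm V b lam k x = groupNorm V b lam k y
  | 0 => rfl
  | 1 => h 1
  | k + 2 => by rw [groupNorm, groupNorm, h, groupNorm_eq_of_norm_coord_eq x y h (k + 1)]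

theorem coord_dilation {s : ℕ} (t : ℝ) (x : 𝔥) {j : ℕ} (hj1 : 1 ≤ j) (hjs : j ≤ s) :
    coord V b j (dilation V s t x) = t ^ j • coord V b j x := by
  rw [dilation, coord_sum, Finset.sum_eq_single j]
  · rw [coord_smul, coord_component_same]
  · intro i _ hij
    rw [coord_smul, coord_of_mem_ne V b (component V i x).2 hij, smul_zero]
  · intro h
    exact absurd (Finset.mem_Icc.2 ⟨hj1, hjs⟩) h

theorem normPow_dilation (hl : ∀ j, 0 ≤ lam j) {s : ℕ} {t : ℝ} (ht : 0 ≤ t) (x : 𝔥) {k : ℕ}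
    (hk : 1 ≤ k) (hks : k ≤ s) :
    normPow V b lam k (dilation V s t x) = t ^ (2 * k !) * normPow V b lam k x := by
  induction k, hk using Nat.le_induction with
  | base =>
    rw [normPow_one, normPow_one, coord_dilation t x le_rfl hks, norm_smul, pow_one,
      Real.norm_of_nonneg ht, mul_pow, Nat.factorial_one, mul_one]
  | succ k hk ih =>
    have e : 2 * (k + 1)! = 2 * k ! * (k + 1) := by
      rw [Nat.factorial_succ]
      ring
    rw [normPow_succ V b hl hk, normPow_succ V b hl hk, ih (by omega),
      coord_dilation t x (by omega) hks, norm_smul, norm_pow, Real.norm_of_nonneg ht, mul_pow,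
      mul_pow, e, ← pow_mul, ← pow_mul, mul_comm (k + 1) (2 * k !)]
    ring

theorem coord_eq_zero_of_normPow_eq_zero (hl : ∀ j, 0 < lam j) (x : 𝔥) {k : ℕ} (hk : 1 ≤ k)
    (h : normPow V b lam k x = 0) {j : ℕ} (hj : 1 ≤ j) (hjk : j ≤ k) : coord V b j x = 0 := by
  have hl0 : ∀ j, 0 ≤ lam j := fun j => (hl j).le
  induction k, hk using Nat.le_induction with
  | base =>
    obtain rfl : j = 1 := by omega
    simpa [normPow_one] using h
  | succ k hk ih =>
    rw [normPow_succ V b hl0 hk] at h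
    have h0 := normPow_nonneg V b hl0 k x
    have h1 := hl (k + 1)
    rw [add_eq_zero_iff_of_nonneg (by positivity) (by positivity)] at h
    obtain rfl | hlt : j = k + 1 ∨ j ≤ k := by omega
    · exact norm_eq_zero.1 (eq_zero_of_pow_eq_zero ((mul_eq_zero.1 h.2).resolve_left h1.ne'))
    · exact ih (eq_zero_of_pow_eq_zero h.1) hlt

theorem isHomogeneousQuasiNorm_groupNorm [FiniteDimensional ℝ 𝔥] [TopologicalSpace 𝔥]
    [IsTopologicalAddGroup 𝔥] [ContinuousSMul ℝ 𝔥] [T2Space 𝔥] {s : ℕ} (hs : 1 ≤ s)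
    (hV : ∀ j, j = 0 ∨ s < j → V j = ⊥) (hl : ∀ j, 0 < lam j)
    (hdef : ∀ g h : 𝔥, 0 ≤ convexityDefect V b lam s s g h) :
    IsHomogeneousQuasiNorm V s (groupNorm V b lam s) := by
  have hl0 : ∀ j, 0 ≤ lam j := fun j => (hl j).le
  have hN := groupNorm_nonneg V b hl0 s
  have hm : 2 * s ! ≠ 0 := by positivity
  refine ⟨continuous_groupNorm V b s, hN, fun x => ?_, fun t ht x => ?_, fun x => ⟨fun h => ?_, ?_⟩,
    2, fun x y => ?_⟩
  · exact groupNorm_eq_of_norm_coord_eq _ _ (fun j => by rw [coord_neg, norm_neg]) s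
  · have h := normPow_dilation (b := b) hl0 ht x hs le_rfl
    rw [normPow, normPow, ← mul_pow] at h
    exact (pow_left_inj₀ (hN _) (mul_nonneg ht (hN _)) hm).1 h
  · have h0 : normPow V b lam s x = 0 := by rw [normPow, h, zero_pow hm]
    refine eq_zero_of_coord_eq_zero V b fun j => ?_
    by_cases hj : 1 ≤ j ∧ j ≤ s
    · exact coord_eq_zero_of_normPow_eq_zero hl x hs h0 hj.1 hj.2
    · exact coord_of_eq_bot V b (hV j (by omega)) x
  · rintro rfl
    -- Homogeneity with `t = 0` forces the norm to vanish at the identity.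
    have h := normPow_dilation (b := b) hl0 le_rfl (0 : 𝔥) hs le_rfl
    have h0 : GradedNilpotent.dilation V s 0 (0 : 𝔥) = 0 := by simp [dilation, component_zero]
    rw [h0, zero_pow hm, zero_mul, normPow] at h
    exact eq_zero_of_pow_eq_zero h
  -- The mean of the two powers is at most `(N x + N y) ^ (2 * s !)`, so taking roots gives the
  -- constant 2.
  · have h := hdef x y
    rw [convexityDefect, sub_nonneg, normPow, normPow, normPow, ← div_pow] at h
    have hx := hN x
    have hy := hN y
    have h1 : groupNorm V b lam s x ^ (2 * s !) ≤
        (groupNorm V b lam s x + groupNorm V b lam s y) ^ (2 * s !) := by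
      gcongr
      linarith
    have h2 : groupNorm V b lam s y ^ (2 * s !) ≤
        (groupNorm V b lam s x + groupNorm V b lam s y) ^ (2 * s !) := by
      gcongr
      linarith
    have := le_of_pow_le_pow_left₀ hm (add_nonneg hx hy)
      (h.trans (by linarith : _ ≤ (groupNorm V b lam s x + groupNorm V b lam s y) ^ (2 * s !)))
    linarith

end QuasiNorm

end GradedNilpotent

/-! ### The main theorem -/

open GradedNilpotent in
open scoped Nat in
theorem proposition7p2 {s : ℕ} (hs : 1 ≤ s)
    {𝔥 : Type*} [LieRing 𝔥] [LieAlgebra ℝ 𝔥] [FiniteDimensional ℝ 𝔥]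
    [TopologicalSpace 𝔥] [IsTopologicalAddGroup 𝔥] [ContinuousSMul ℝ 𝔥] [T2Space 𝔥]
    (V : ℕ → Submodule ℝ 𝔥) [GradedLieAlgebra V]
    (hV : ∀ j, j = 0 ∨ s < j → V j = ⊥)
    (b : ∀ j, Module.Basis (Fin (Module.finrank ℝ (V j))) ℝ (V j)) :
    ∃ lam : ℕ → ℝ, (∀ k, 2 ≤ k → k ≤ s → 0 < lam k) ∧
      IsHomogeneousQuasiNorm V s (groupNorm V b lam s) ∧
      ∃ C : ℝ, 0 < C ∧ ∀ g h : 𝔥,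
        (groupNorm V b lam s (bch s g h) / 2) ^ (2 * s !) +
            C / 2 ^ (2 * s !) *
              (‖coord V b 1 g - coord V b 1 h‖ ^ (2 * s !) +
                nonhorizontality V s (groupNorm V b lam s) (bch s g h) ^ (2 * s !)) ≤
          (groupNorm V b lam s g ^ (2 * s !) + groupNorm V b lam s h ^ (2 * s !)) / 2 := by
  have hV0 : V 0 = ⊥ := hV 0 (Or.inl rfl)
  obtain ⟨lam, hl, A, hA, H⟩ := exists_defectControls b hV hs le_rfl
  obtain ⟨B, hB0, hB⟩ := exists_normPow_le V b (fun j => (hl j).le) hs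
  refine ⟨lam, fun k _ _ => hl k,
    isHomogeneousQuasiNorm_groupNorm hs hV hl (H.defect_nonneg hA),
    -- The power of 2 cancels the normalization in the statement; 1 and `B` are the shares of `|g₁ -
    -- h₁|` and `NH (gh)`, and `A` converts `δ` into the defect.
    2 ^ (2 * s !) / ((1 + B) * A), by positivity, fun g h => ?_⟩
  obtain ⟨δ, hw, hδ⟩ := H g h
  have h1 : ‖coord V b 1 g - coord V b 1 h‖ ^ (2 * s !) ≤ δ ^ (2 * s !) := by
    gcongr
    exact hw.sub_one
  have h2 : nonhorizontality V s (groupNorm V b lam s) (bch s g h) ^ (2 * s !) ≤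
      B * δ ^ (2 * s !) := by
    refine hB (vertical V s (bch s g h)) δ hw.nonneg fun j hj => ?_
    rcases Nat.eq_zero_or_pos j with rfl | hj0
    -- The vertical part has no first layer, which is why `HorizontalWithin` constrains it only from
    -- degree 2 on.
    · rw [zero_add, coord_one_vertical hV0 hs, norm_zero, pow_one]
      exact hw.nonneg
    · exact hw.vertical j hj0 hj
  have h3 : 1 / ((1 + B) * A) *
      (‖coord V b 1 g - coord V b 1 h‖ ^ (2 * s !) +
        nonhorizontality V s (groupNorm V b lam s) (bch s g h) ^ (2 * s !)) ≤
      convexityDefect V b lam s s g h := by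
    rw [one_div, inv_mul_le_iff₀ (by positivity)]
    calc _ ≤ (1 + B) * δ ^ (2 * s !) := by linarith
      _ ≤ (1 + B) * (A * convexityDefect V b lam s s g h) := by gcongr
      _ = _ := by ring
  have h4 : (2 : ℝ) ^ (2 * s !) / ((1 + B) * A) / 2 ^ (2 * s !) = 1 / ((1 + B) * A) := by
    field_simp
  rw [h4, div_pow]
  simp only [convexityDefect, normPow] at h3
  linarith
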